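/- Let $R$ be an associative ring with identity, and let "module" mean unital right $R$-module. A module $M$ is $N$-projective if for every epimorphism $g : N \to K$ and every morphism $\psi : M \to K$ there is a morphism $\varphi : M \to N$ with $g\varphi = \psi$; the projectivity domain of $M$ is the class $\mathfrak{Pr}^{-1}(M)$ of all modules $N$ such that $M$ is $N$-projective; and the right $p$-profile $p\mathcal{P}(R)$ is the collection of the classes $\mathfrak{Pr}^{-1}(M)$, for all modules $M$, ordered by inclusion. For a two-sided ideal $I$ of $R$, identify $\mathrm{Mod}\text{-}R/I$ with the class of all modules $N$ such that $NI = 0$. Suppose that $R$ is right perfect, that is, every module $M$ has a projective cover (an epimorphism onto $M$ from a projective module, with superfluous kernel). Then $\mathrm{Mod}\text{-}R/I = \mathfrak{Pr}^{-1}(R/I)$ for every two-sided ideal $I$ contained in the Jacobson radical $J(R)$, and $I \mapsto \mathrm{Mod}\text{-}R/I$ is an anti-isomorphism from the lattice of two-sided ideals of $R$ contained in $J(R)$, ordered by inclusion, onto $p\mathcal{P}(R)$: it is a bijection, and $I \subseteq I'$ if and only if $\mathrm{Mod}\text{-}R/I' \subseteq \mathrm{Mod}\text{-}R/I$. -/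

import Mathlib

/-!
Right modules over `R` are modules over the opposite ring `Rᵐᵒᵖ`: the right action of `r` on `x` is
`MulOpposite.op r • x`, and a class of right modules is a set in `ModuleCat Rᵐᵒᵖ`.
-/

universe u

namespace ProjProfile

/-- A submodule `K` of `M` is superfluous (small) if `K + L = M` forces `L = M`. -/
def IsSuperfluous {S M : Type u} [Ring S] [AddCommGroup M] [Module S M]
    (K : Submodule S M) : Prop :=
  ∀ L : Submodule S M, K ⊔ L = ⊤ → L = ⊤

/-- A projective cover of `M`: an epimorphism from a projective module onto `M` whose kernel is
superfluous. -/
structure IsProjectiveCover {S P M : Type u} [Ring S] [AddCommGroup P] [Module S P]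
    [AddCommGroup M] [Module S M] (π : P →ₗ[S] M) : Prop where
  projective : Module.Projective S P
  surjective : Function.Surjective π
  superfluous : IsSuperfluous (LinearMap.ker π)

/-- A ring is right perfect if every right module has a projective cover. -/
def IsRightPerfect (R : Type u) [Ring R] : Prop :=
  ∀ M : ModuleCat.{u} Rᵐᵒᵖ, ∃ (P : ModuleCat.{u} Rᵐᵒᵖ) (π : P →ₗ[Rᵐᵒᵖ] M), IsProjectiveCover π

/-- `M` is `N`-projective (projective relative to `N`): every morphism from `M` to the target `K` of
an epimorphism `g : N → K` factors through `g`. -/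
def IsRelProjective {S : Type u} [Ring S] (M N : ModuleCat.{u} S) : Prop :=
  ∀ (K : ModuleCat.{u} S) (g : N →ₗ[S] K) (ψ : M →ₗ[S] K), Function.Surjective g →
    ∃ φ : M →ₗ[S] N, g ∘ₗ φ = ψ

/-- The projectivity domain of the right `R`-module `M`. -/
def projDomain {R : Type u} [Ring R] (M : ModuleCat.{u} Rᵐᵒᵖ) : Set (ModuleCat.{u} Rᵐᵒᵖ) :=
  {N | IsRelProjective M N}

/-- The right `p`-profile of `R`: the collection of the projectivity domains of all right
`R`-modules, ordered by inclusion. -/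
def pProfile (R : Type u) [Ring R] : Set (Set (ModuleCat.{u} Rᵐᵒᵖ)) :=
  {A | ∃ M : ModuleCat.{u} Rᵐᵒᵖ, A = projDomain M}

/-- A two-sided ideal, as a submodule of the right module `R`. -/
def rightSubmodule {R : Type u} [Ring R] (I : TwoSidedIdeal R) : Submodule Rᵐᵒᵖ R where
  carrier := I
  add_mem' := I.add_mem
  zero_mem' := I.zero_mem
  smul_mem' r _ hx := I.mul_mem_right _ r.unop hx

/-- The right `R`-module `R/I`. -/
abbrev quotientModule {R : Type u} [Ring R] (I : TwoSidedIdeal R) : ModuleCat.{u} Rᵐᵒᵖ :=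
  ModuleCat.of Rᵐᵒᵖ (R ⧸ rightSubmodule I)

/-- The class `Mod-R/I`, as a class of right `R`-modules: those `N` with `N I = 0`, that is, those
whose `R`-action factors through `R/I`. -/
def modQuotient {R : Type u} [Ring R] (I : TwoSidedIdeal R) : Set (ModuleCat.{u} Rᵐᵒᵖ) :=
  {N | ∀ a ∈ I, ∀ x : N, MulOpposite.op a • x = 0}

end ProjProfile

/-!
The argument rests on a criterion for relative projectivity: if `π : P → M` is a projective cover,
then `M` is `N`-projective if and only if every morphism `P → N` kills `ker π`
(`IsProjectiveCover.isRelProjective_iff`).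

Since `P` is projective, the elements of `ker π` are recovered from their images under the
functionals `P → R`. Hence every morphism `P → N` kills `ker π` exactly when `N` is annihilated by
the two-sided ideal generated by these images, the trace ideal of `ker π`
(`forall_map_eq_zero_iff_mem_modQuotient`). Images of superfluous submodules are superfluous, and a
superfluous right ideal lies in the Jacobson radical, so the trace ideal is contained in `J(R)`
(`traceIdeal_le_jacobson`). When every module has a projective cover, each projectivity domain is
therefore of the form `Mod-R/I` with `I ⊆ J(R)`.

Conversely, for `I ⊆ J(R)` the projection `R → R/I` is a projective cover, and the same criterion
applied to it gives `Pr⁻¹(R/I) = Mod-R/I`. Finally `I` is the annihilator of `R/I`, so `Mod-R/I`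
determines `I`, and the inclusions are reversed.
-/

namespace ProjProfile

/-! ### Projective covers and relative projectivity -/

section Superfluous

variable {S : Type u} [Ring S] {P N : Type u} [AddCommGroup P] [Module S P]
  [AddCommGroup N] [Module S N]

lemma IsSuperfluous.map {K : Submodule S P} (hK : IsSuperfluous K) (f : P →ₗ[S] N) :
    IsSuperfluous (K.map f) := by
  intro L hL
  have hcomap : L.comap f = ⊤ := by
    refine hK _ (eq_top_iff.2 fun p _ ↦ ?_)
    obtain ⟨_, ⟨k, hk, rfl⟩, l, hl, h⟩ :=
      Submodule.mem_sup.1 (hL ▸ Submodule.mem_top : f p ∈ K.map f ⊔ L)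
    refine Submodule.mem_sup.2 ⟨k, hk, p - k, ?_, by abel⟩
    rw [Submodule.mem_comap, map_sub, ← h]
    simpa using hl
  have hle : K.map f ≤ L := Submodule.map_le_iff_le_comap.2 (hcomap ▸ le_top)
  rwa [sup_eq_right.2 hle] at hL

/-- If `h` sends all of `P` into the image of the superfluous submodule `K`, then `K + ker h = P`,
which forces `h = 0`. -/
lemma IsSuperfluous.eq_zero_of_range_le_map {K : Submodule S P} (hK : IsSuperfluous K)
    {h : P →ₗ[S] N} (hh : LinearMap.range h ≤ K.map h) : h = 0 := by
  refine LinearMap.ker_eq_top.1 (hK _ (eq_top_iff.2 fun p _ ↦ ?_))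
  obtain ⟨k, hk, hkp⟩ := hh ⟨p, rfl⟩
  exact Submodule.mem_sup.2 ⟨k, hk, p - k, by simp [hkp], by abel⟩

end Superfluous

/-- Relative projectivity read off a projective cover `π : P → M`: the module `M` is `N`-projective
if and only if all morphisms `P → N` kill `ker π`, that is, factor through `π`. -/
lemma IsProjectiveCover.isRelProjective_iff {S : Type u} [Ring S] {P M : ModuleCat.{u} S}
    {π : P →ₗ[S] M} (hπ : IsProjectiveCover π) (N : ModuleCat.{u} S) :
    IsRelProjective M N ↔ ∀ f : P →ₗ[S] N, ∀ k ∈ LinearMap.ker π, f k = 0 := by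
  have := hπ.projective
  -- A morphism on `P` killing `ker π` descends to `M`.
  have descend {Q : Type u} [AddCommGroup Q] [Module S Q] (f : P →ₗ[S] Q)
      (hf : ∀ k ∈ LinearMap.ker π, f k = 0) : ∃ φ : M →ₗ[S] Q, φ ∘ₗ π = f := by
    refine ⟨(LinearMap.ker π).liftQ f hf ∘ₗ
      (π.quotKerEquivOfSurjective hπ.surjective).symm.toLinearMap, LinearMap.ext fun p ↦ ?_⟩
    have : (π.quotKerEquivOfSurjective hπ.surjective).symm (π p) =
        (LinearMap.ker π).mkQ p := by
      rw [LinearEquiv.symm_apply_eq]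
      rfl
    exact (congrArg ((LinearMap.ker π).liftQ f hf) this).trans
      (Submodule.liftQ_apply (LinearMap.ker π) f p)
  constructor
  · intro hMN f
    -- Lift the map `M → N / f(ker π)` induced by `f` to some `φ : M → N`; then `f - φ ∘ π` has
    -- range in `f(ker π)` and agrees with `f` on `ker π`, hence vanishes.
    obtain ⟨ψ, hψ⟩ := descend (((LinearMap.ker π).map f).mkQ ∘ₗ f) fun k hk ↦ by
      simpa using ⟨k, hk, rfl⟩
    obtain ⟨φ, hφ⟩ := hMN (ModuleCat.of S (N ⧸ (LinearMap.ker π).map f))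
      ((LinearMap.ker π).map f).mkQ ψ (Submodule.mkQ_surjective _)
    have hzero : f - φ ∘ₗ π = 0 := by
      refine hπ.superfluous.eq_zero_of_range_le_map ?_
      rintro _ ⟨p, rfl⟩
      have hp : (f - φ ∘ₗ π) p ∈ (LinearMap.ker π).map f := by
        rw [← Submodule.ker_mkQ ((LinearMap.ker π).map f), LinearMap.mem_ker, LinearMap.sub_apply,
          map_sub, sub_eq_zero]
        have h1 := LinearMap.congr_fun hψ p
        have h2 := LinearMap.congr_fun hφ (π p)
        exact h1.symm.trans h2.symm
      obtain ⟨k, hk, hkp⟩ := hp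
      refine ⟨k, hk, ?_⟩
      rw [← hkp, LinearMap.sub_apply, LinearMap.comp_apply, LinearMap.mem_ker.1 hk, map_zero,
        sub_zero]
    intro k hk
    have := LinearMap.congr_fun hzero k
    rwa [LinearMap.sub_apply, LinearMap.comp_apply, LinearMap.mem_ker.1 hk, map_zero,
      sub_zero] at this
  · intro hf K g ψ hg
    obtain ⟨f, hgf⟩ := Module.projective_lifting_property g (ψ ∘ₗ π) hg
    obtain ⟨φ, rfl⟩ := descend f (hf f)
    refine ⟨φ, LinearMap.ext fun m ↦ ?_⟩
    obtain ⟨p, rfl⟩ := hπ.surjective m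
    exact LinearMap.congr_fun hgf p

section Ring

variable {R : Type u} [Ring R]

/-! ### Superfluous right ideals and the Jacobson radical -/

/-- The inverse is two-sided because a left inverse of `1 + x` again has the form `1 + x'` with `x'`
in the radical. -/
lemma isUnit_one_add_of_mem_jacobson {x : R} (hx : x ∈ Ring.jacobson R) : IsUnit (1 + x) := by
  have left_inv : ∀ y ∈ Ring.jacobson R, ∃ z, z * (1 + y) = 1 := fun y hy ↦ by
    rw [← Ideal.jacobson_bot, Ideal.mem_jacobson_iff] at hy
    obtain ⟨z, hz⟩ := hy 1
    rw [Ideal.mem_bot, sub_eq_zero] at hz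
    exact ⟨z, by rw [mul_add, mul_one, add_comm, ← hz, mul_one]⟩
  obtain ⟨z, hz⟩ := left_inv x hx
  obtain ⟨w, hw⟩ := left_inv (-(z * x)) (neg_mem (Ideal.mul_mem_left _ _ hx))
  have hzx : 1 + -(z * x) = z := by rw [← hz]; noncomm_ring
  rw [hzx] at hw
  exact ⟨⟨1 + x, z, left_inv_eq_right_inv hw hz ▸ hw, hz⟩, rfl⟩

lemma isSuperfluous_rightSubmodule {I : TwoSidedIdeal R} (hI : I ≤ (Ring.jacobson R).toTwoSided) :
    IsSuperfluous (rightSubmodule I) := by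
  intro L hL
  obtain ⟨a, ha, l, hl, h⟩ :=
    Submodule.mem_sup.1 (hL ▸ Submodule.mem_top : (1 : R) ∈ rightSubmodule I ⊔ L)
  have ha' : a ∈ Ring.jacobson R := Ideal.mem_toTwoSided.1 (hI ha)
  obtain ⟨u, hu⟩ := isUnit_one_add_of_mem_jacobson (neg_mem ha')
  have hlu : l = u := by rw [hu, ← h]; abel
  refine eq_top_iff.2 fun r _ ↦ ?_
  have := L.smul_mem (MulOpposite.op (↑u⁻¹ * r)) hl
  rwa [op_smul_eq_mul, hlu, Units.mul_inv_cancel_left] at this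

lemma IsSuperfluous.exists_mul_eq_one {K : Submodule Rᵐᵒᵖ R} (hK : IsSuperfluous K) {x : R}
    (hx : x ∈ K) : ∃ u, (1 + x) * u = 1 := by
  have h : Submodule.span Rᵐᵒᵖ {1 + x} = ⊤ := by
    refine hK _ (eq_top_iff.2 fun r _ ↦ Submodule.mem_sup.2 ?_)
    refine ⟨-(x * r), neg_mem (K.smul_mem (MulOpposite.op r) hx), (1 + x) * r,
      Submodule.smul_mem _ (MulOpposite.op r) (Submodule.mem_span_singleton_self _), ?_⟩
    noncomm_ring
  obtain ⟨u, hu⟩ := Submodule.mem_span_singleton.1 (h ▸ Submodule.mem_top :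
    (1 : R) ∈ Submodule.span Rᵐᵒᵖ {1 + x})
  exact ⟨u.unop, hu⟩

/-- Left multiplication by `y` is an endomorphism of the right module `R`, so `y K` is superfluous
as well; this turns right inverses of the elements `1 + y x` into two-sided ones. -/
lemma IsSuperfluous.le_jacobson {K : Submodule Rᵐᵒᵖ R} (hK : IsSuperfluous K) {x : R}
    (hx : x ∈ K) : x ∈ Ring.jacobson R := by
  rw [← Ideal.jacobson_bot, Ideal.mem_jacobson_iff]
  intro y
  have hyx : y * x ∈ K.map (DistribSMul.toLinearMap Rᵐᵒᵖ R y) := ⟨x, hx, rfl⟩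
  have hyK := hK.map (DistribSMul.toLinearMap Rᵐᵒᵖ R y)
  obtain ⟨v, hv⟩ := hyK.exists_mul_eq_one hyx
  have hv' : 1 + -(y * x * v) = v := by rw [← hv]; noncomm_ring
  obtain ⟨w, hw⟩ := hyK.exists_mul_eq_one
    (neg_mem (Submodule.smul_mem _ (MulOpposite.op v) hyx))
  rw [op_smul_eq_mul, hv'] at hw
  refine ⟨v, ?_⟩
  rw [← left_inv_eq_right_inv hv hw, mul_add, mul_one, ← mul_assoc] at hw
  rw [Ideal.mem_bot, ← hw]
  abel

/-! ### Trace ideals -/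

/-- The trace ideal of a submodule `K` of a right module `P`: the two-sided ideal generated by the
images of `K` under all functionals `P → R`. -/
def traceIdeal {P : Type u} [AddCommGroup P] [Module Rᵐᵒᵖ P] (K : Submodule Rᵐᵒᵖ P) :
    TwoSidedIdeal R :=
  TwoSidedIdeal.span {a | ∃ f : P →ₗ[Rᵐᵒᵖ] R, ∃ k ∈ K, f k = a}

lemma traceIdeal_le_jacobson {P : Type u} [AddCommGroup P] [Module Rᵐᵒᵖ P]
    {K : Submodule Rᵐᵒᵖ P} (hK : IsSuperfluous K) :
    traceIdeal K ≤ (Ring.jacobson R).toTwoSided := by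
  refine TwoSidedIdeal.span_le.2 ?_
  rintro _ ⟨f, k, hk, rfl⟩
  exact Ideal.mem_toTwoSided.2 ((hK.map f).le_jacobson ⟨k, hk, rfl⟩)

/-- The morphism of right modules `R → N` sending `1` to `n`. -/
def orbitMap {N : Type u} [AddCommGroup N] [Module Rᵐᵒᵖ N] (n : N) : R →ₗ[Rᵐᵒᵖ] N where
  toFun r := MulOpposite.op r • n
  map_add' r s := by rw [MulOpposite.op_add, add_smul]
  map_smul' t r := by
    rw [RingHom.id_apply, ← mul_smul]
    rfl

lemma forall_map_eq_zero_iff_mem_modQuotient {P : Type u} [AddCommGroup P] [Module Rᵐᵒᵖ P]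
    [Module.Projective Rᵐᵒᵖ P] (K : Submodule Rᵐᵒᵖ P) (N : ModuleCat.{u} Rᵐᵒᵖ) :
    (∀ f : P →ₗ[Rᵐᵒᵖ] N, ∀ k ∈ K, f k = 0) ↔ N ∈ modQuotient (traceIdeal K) := by
  constructor
  · intro h a ha
    induction ha using TwoSidedIdeal.span_induction with
    | mem a ha =>
      obtain ⟨f, k, hk, rfl⟩ := ha
      exact fun x ↦ h (orbitMap x ∘ₗ f) k hk
    | zero => simp
    | add a b _ _ ha hb => intro x; rw [MulOpposite.op_add, add_smul, ha, hb, add_zero]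
    | neg a _ ha => intro x; rw [MulOpposite.op_neg, neg_smul, ha, neg_zero]
    | left_absorb b a _ ha => intro x; rw [MulOpposite.op_mul, mul_smul, ha]
    | right_absorb b a _ ha => intro x; rw [MulOpposite.op_mul, mul_smul, ha, smul_zero]
  · intro hN f k hk
    -- Expand `k` in a dual basis of `P`: its coordinates are values of functionals `P → R`.
    obtain ⟨s, hs⟩ := Module.projective_def'.1 (inferInstance : Module.Projective Rᵐᵒᵖ P)
    have hsk := LinearMap.congr_fun hs k
    rw [LinearMap.comp_apply, Finsupp.linearCombination_apply, LinearMap.id_apply] at hsk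
    rw [← hsk, Finsupp.sum, map_sum]
    refine Finset.sum_eq_zero fun p _ ↦ ?_
    let c : P →ₗ[Rᵐᵒᵖ] R :=
      { toFun q := (s q p).unop
        map_add' := by simp
        map_smul' := by simp }
    rw [map_smul]
    exact hN (c k) (TwoSidedIdeal.subset_span ⟨c, k, hk, rfl⟩) _

/-! ### Projectivity domains -/

/-- The free right module of rank one. -/
lemma projective_op_self : Module.Projective Rᵐᵒᵖ R :=
  .of_equiv (σ := RingHom.id Rᵐᵒᵖ) (σ' := RingHom.id Rᵐᵒᵖ) (M := Rᵐᵒᵖ) (N := R)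
    { (MulOpposite.opAddEquiv (α := R)).symm with map_smul' := fun _ _ ↦ rfl }

lemma isProjectiveCover_mkQ {I : TwoSidedIdeal R} (hI : I ≤ (Ring.jacobson R).toTwoSided) :
    IsProjectiveCover (rightSubmodule I).mkQ where
  projective := projective_op_self
  surjective := Submodule.mkQ_surjective _
  superfluous := by
    rw [Submodule.ker_mkQ]
    exact isSuperfluous_rightSubmodule hI

lemma modQuotient_eq_projDomain {I : TwoSidedIdeal R} (hI : I ≤ (Ring.jacobson R).toTwoSided) :
    modQuotient I = projDomain (quotientModule I) := by
  ext N
  have hcover := IsProjectiveCover.isRelProjective_iff (P := ModuleCat.of Rᵐᵒᵖ R)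
    (M := quotientModule I) (isProjectiveCover_mkQ hI) N
  refine Iff.trans ?_ hcover.symm
  rw [Submodule.ker_mkQ]
  constructor
  · intro hN f a ha
    have hfa : f a = MulOpposite.op a • f (1 : R) := by
      rw [← map_smul, op_smul_eq_mul, one_mul]
    rw [hfa]
    exact hN a ha _
  · exact fun h a ha x ↦ h (orbitMap x) a ha

lemma IsProjectiveCover.projDomain_eq {P M : ModuleCat.{u} Rᵐᵒᵖ} {π : P →ₗ[Rᵐᵒᵖ] M}
    (hπ : IsProjectiveCover π) :
    projDomain M = modQuotient (traceIdeal (LinearMap.ker π)) := by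
  have := hπ.projective
  ext N
  exact (hπ.isRelProjective_iff N).trans (forall_map_eq_zero_iff_mem_modQuotient _ N)

/-- The forward direction evaluates the inclusion of classes at the module `R/I'`, whose annihilator
is `I'`. -/
lemma modQuotient_subset_modQuotient_iff {I I' : TwoSidedIdeal R} :
    modQuotient I' ⊆ modQuotient I ↔ I ≤ I' := by
  refine ⟨fun h a ha ↦ ?_, fun h N hN a ha ↦ hN a (h ha)⟩
  have hmem : quotientModule I' ∈ modQuotient I' := by
    intro b hb x
    obtain ⟨r, rfl⟩ := Submodule.mkQ_surjective _ x
    rw [← map_smul, op_smul_eq_mul]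
    exact (Submodule.Quotient.mk_eq_zero _).2 (I'.mul_mem_left r b hb)
  have h1 := h hmem a ha ((rightSubmodule I').mkQ 1)
  rw [← map_smul, op_smul_eq_mul, one_mul] at h1
  exact (Submodule.Quotient.mk_eq_zero _).1 h1

end Ring

end ProjProfile

/-- For a right perfect ring `R`, sending a two-sided ideal `I ⊆ J(R)` to `Mod-R/I`, which is the
projectivity domain of `R/I`, is an anti-isomorphism from the lattice of two-sided ideals contained
in `J(R)` onto the right `p`-profile of `R`. -/
theorem proposition4p4 (R : Type u) [Ring R] (hR : ProjProfile.IsRightPerfect R) :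
    ∃ e : (Set.Iic (Ring.jacobson R).toTwoSided)ᵒᵈ ≃o ProjProfile.pProfile R,
      ∀ I : Set.Iic (Ring.jacobson R).toTwoSided,
        (e (OrderDual.toDual I) : Set (ModuleCat.{u} Rᵐᵒᵖ)) =
            ProjProfile.modQuotient (I : TwoSidedIdeal R) ∧
          ProjProfile.modQuotient (I : TwoSidedIdeal R) =
            ProjProfile.projDomain (ProjProfile.quotientModule (I : TwoSidedIdeal R)) := by
  let e : (Set.Iic (Ring.jacobson R).toTwoSided)ᵒᵈ ↪o ProjProfile.pProfile R :=
    OrderEmbedding.ofMapLEIff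
      (fun I ↦ ⟨ProjProfile.modQuotient (OrderDual.ofDual I).1,
        ProjProfile.quotientModule (OrderDual.ofDual I).1,
        ProjProfile.modQuotient_eq_projDomain (OrderDual.ofDual I).2⟩)
      fun _ _ ↦ ProjProfile.modQuotient_subset_modQuotient_iff
  have he : Function.Surjective e := by
    rintro ⟨_, M, rfl⟩
    obtain ⟨P, π, hπ⟩ := hR M
    exact ⟨OrderDual.toDual ⟨ProjProfile.traceIdeal (LinearMap.ker π),
      ProjProfile.traceIdeal_le_jacobson hπ.superfluous⟩, Subtype.ext hπ.projDomain_eq.symm⟩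
  exact ⟨RelIso.ofSurjective e he, fun I ↦
    ⟨rfl, ProjProfile.modQuotient_eq_projDomain I.2⟩⟩
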